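/- Let $G$ be a finite graph and let $L$ be a $q$-list assignment of $G$, that is, an assignment to each vertex $v$ of a set $L(v)\subset\mathbb N$ of $q$ colors, listed in ascending order as $c_{1,v}<\dots<c_{q,v}$. An $L$-coloring is a proper coloring $f$ of $G$ with $f(v)\in L(v)$ for all $v$. An $L$-packing is a family $f_1,\dots,f_q$ of $L$-colorings that are pairwise disjoint, i.e. $f_i(v)\neq f_j(v)$ for all $v$ and all $i\ne j$. It is encoded by $\omega=(\omega_v)_{v\in V(G)}\in S_q^{V(G)}$ through $f_i(v)=c_{\omega_v(i),v}$, and $\Omega\subseteq S_q^{V(G)}$ denotes the set of all such $\omega$. For $\omega\in\Omega$ and $u\in V(G)$, a permutation $\rho\in S_q$ is available for $u$ in $\omega$ if replacing $\omega_u$ by $\rho$ yields an element of $\Omega$. The heat-bath Glauber dynamics $\mathcal M(G,L)$ is the Markov chain on $\Omega$ which, from state $\omega$, chooses $u\in V(G)$ uniformly at random, then a permutation $\rho$ available for $u$ in $\omega$ uniformly at random, and replaces $\omega_u$ by $\rho$. For a chain on $\Omega$ with unique stationary distribution $\pi$, write $p_t$ for its distribution after $t$ steps from the initial distribution $p_0$,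 and let $t_{\mathrm{mix}}(\varepsilon)=\max_{p_0}\min\{t\ge 0: d_{\mathrm{TV}}(p_t,\pi)\le\varepsilon\}$, where $d_{\mathrm{TV}}$ is total variation distance. **Theorem.** There is an absolute constant $C>0$ such that for all integers $\Delta\ge 1$ and $q\ge C\Delta^2$ there is a constant $K=K(\Delta,q)>0$ with the following property. Let $G$ be an $n$-vertex graph of maximum degree $\Delta$ and let $L$ be a $q$-list assignment of $G$. Then $\Omega$ is non-empty, the uniform distribution on $\Omega$ is the unique stationary distribution of the heat-bath Glauber dynamics $\mathcal M(G,L)$, and for every $\varepsilon\in(0,1)$ its mixing time satisfies $$t_{\mathrm{mix}}(\varepsilon)\le K\,n\log(n/\varepsilon).$$ -/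

import Mathlib

open scoped ENNReal

noncomputable section

/-- A proper colouring `f` of `G` with `f v ∈ L v` for every vertex `v`. -/
def IsListColoring {V : Type*} (G : SimpleGraph V) (L : V → Finset ℕ) (f : V → ℕ) : Prop :=
  (∀ u v, G.Adj u v → f u ≠ f v) ∧ ∀ v, f v ∈ L v

/-- A family of `q` pairwise disjoint `L`-colourings of `G`. -/
def IsListPacking {V : Type*} (G : SimpleGraph V) (L : V → Finset ℕ) {q : ℕ}
    (f : Fin q → V → ℕ) : Prop :=
  (∀ i, IsListColoring G L (f i)) ∧ ∀ i j, i ≠ j → ∀ v, f i v ≠ f j v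

/-- The `q` colourings encoded by a permutation at each vertex: when `L v` is listed in ascending
order as `c₀ < ⋯ < c_{q-1}`, the `i`-th colouring gives `v` the colour `c_{ω v i}`. -/
def coloringsOf {V : Type*} {q : ℕ} (L : V → Finset ℕ) (hL : ∀ v, (L v).card = q)
    (ω : V → Equiv.Perm (Fin q)) (i : Fin q) (v : V) : ℕ :=
  (L v).orderEmbOfFin (hL v) (ω v i)

/-- The state space `Ω ⊆ S_q^V` of `L`-packings. -/
def PackingState {V : Type*} {q : ℕ} (G : SimpleGraph V) (L : V → Finset ℕ)
    (hL : ∀ v, (L v).card = q) : Type _ :=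
  {ω : V → Equiv.Perm (Fin q) // IsListPacking G L (coloringsOf L hL ω)}

instance {V : Type*} [Fintype V] {q : ℕ} (G : SimpleGraph V) (L : V → Finset ℕ)
    (hL : ∀ v, (L v).card = q) : Fintype (PackingState G L hL) := by
  classical exact Subtype.fintype _

/-- The permutations available for `u` in `ω`: those `ρ` for which setting `ω u` to `ρ` yields
an `L`-packing. -/
def AvailablePerm {V : Type*} [DecidableEq V] {q : ℕ} (G : SimpleGraph V) (L : V → Finset ℕ)
    (hL : ∀ v, (L v).card = q) (ω : PackingState G L hL) (u : V) : Type :=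
  {ρ : Equiv.Perm (Fin q) //
    IsListPacking G L (coloringsOf L hL (Function.update ω.1 u ρ))}

instance {V : Type*} [DecidableEq V] {q : ℕ} (G : SimpleGraph V) (L : V → Finset ℕ)
    (hL : ∀ v, (L v).card = q) (ω : PackingState G L hL) (u : V) :
    Fintype (AvailablePerm G L hL ω u) := by
  classical exact Subtype.fintype _

/-- The current permutation is always available. -/
instance {V : Type*} [DecidableEq V] {q : ℕ} (G : SimpleGraph V) (L : V → Finset ℕ)
    (hL : ∀ v, (L v).card = q) (ω : PackingState G L hL) (u : V) :
    Nonempty (AvailablePerm G L hL ω u) :=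
  ⟨⟨ω.1 u, by rw [Function.update_eq_self]; exact ω.2⟩⟩

/-- One step of the heat-bath Glauber dynamics: pick a uniform vertex `u`, then a uniform available
permutation `ρ` for `u`, and replace `ω u` by `ρ`. -/
def glauberStep {V : Type*} [Fintype V] [Nonempty V] [DecidableEq V] {q : ℕ}
    (G : SimpleGraph V) (L : V → Finset ℕ) (hL : ∀ v, (L v).card = q)
    (ω : PackingState G L hL) : PMF (PackingState G L hL) :=
  (PMF.uniformOfFintype V).bind fun u =>
    (PMF.uniformOfFintype (AvailablePerm G L hL ω u)).map fun ρ =>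
      ⟨Function.update ω.1 u ρ.1, ρ.2⟩

/-- The distribution after `t` steps of the chain with transition kernel `P` started from `p₀`. -/
def distAfter {Ω : Type*} (P : Ω → PMF Ω) (p₀ : PMF Ω) : ℕ → PMF Ω
  | 0 => p₀
  | t + 1 => (distAfter P p₀ t).bind P

/-- `π` is a stationary distribution of the chain with transition kernel `P`. -/
def IsStationaryDist {Ω : Type*} (P : Ω → PMF Ω) (π : PMF Ω) : Prop :=
  π.bind P = π

/-- Total variation distance on a finite space. -/
def tvDistance {Ω : Type*} [Fintype Ω] (μ ν : PMF Ω) : ℝ :=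
  (1 / 2) * ∑ ω, |(μ ω).toReal - (ν ω).toReal|

/-- The mixing time `max_{p₀} min {t : d_TV(p_t, π) ≤ ε}`, with value `⊤` if for some `p₀` there is
no such `t`, or if the minima are unbounded. -/
def mixingTime {Ω : Type*} [Fintype Ω] (P : Ω → PMF Ω) (π : PMF Ω) (ε : ℝ) : ℕ∞ :=
  ⨆ p₀ : PMF Ω, ⨅ (t : ℕ) (_ : tvDistance (distAfter P p₀ t) π ≤ ε), (t : ℕ∞)

end

/-! The proof is path coupling in its dual form: instead of coupling two chains, it shows that the
transition operator contracts a Lipschitz seminorm on test functions. The seminorm is the largest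
change of `f` under a transposition at one vertex. The operator `heatBath` acts on functions of all
families of permutations, packings or not. Any two packings are therefore joined by transpositions
through arbitrary families, and no connectivity of the state space is needed beforehand.

Suppose `ω v` changes by a transposition. Resampling at `v` erases the change, and resampling at a
non-neighbour of `v` is blind to it and keeps the bound `c`. At a neighbour `u`, the forbidden
relation loses at most two pairs and gains at most two. The core estimate
`abs_finsetAvg_avoiding_sub_le` says that one forbidden pair moves the average of a `c`-Lipschitz
function by at most `36 D c / q`, so each neighbour costs an extra `144 D c / q`. Averaging over the
`n` vertices, the gain `c` at `v` beats the total loss `144 D² c / q ≤ c / 2`, and the seminorm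
shrinks by the factor `1 - 1 / (2n)` (`SiteLipschitz.heatBath`).

The core estimate is a switching argument: a permutation with `ρ a = y` is matched with about `q`
permutations with `ρ a ≠ y`, each one transposition away.

Iterating the contraction on a sign function bounds total variation by `2 q n exp(-t / (2n))`. This
gives both uniqueness and mixing; the symmetry of the kernel makes the uniform law stationary. -/

/-! ### Permutations avoiding a sparse relation: switching estimates. -/

open Finset in
/-- Every row and every column of the relation `F` has at most `D` elements. -/
def DegreeLE {α : Type*} [Fintype α] (F : α → α → Prop) (D : ℕ) : Prop :=
  open Classical in
  (∀ i, (univ.filter fun k => F i k).card ≤ D) ∧ ∀ k, (univ.filter fun i => F i k).card ≤ D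

/-- The permutations whose graph avoids the relation `F`. -/
noncomputable def avoidingPerms {α : Type*} [Fintype α] [DecidableEq α] (F : α → α → Prop) :
    Finset (Equiv.Perm α) :=
  open Classical in Finset.univ.filter fun ρ => ∀ i, ¬ F i (ρ i)

/-- The average of `f` over the finite set `s`. -/
noncomputable def finsetAvg {β : Type*} (s : Finset β) (f : β → ℝ) : ℝ :=
  (∑ x ∈ s, f x) / s.card

/-- Multiplying by a transposition changes `f` by at most `c`. -/
def SwapLipschitz {α : Type*} [DecidableEq α] (f : Equiv.Perm α → ℝ) (c : ℝ) : Prop :=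
  ∀ ρ i j, |f (ρ * Equiv.swap i j) - f ρ| ≤ c

/-- The positions other than `e` whose value may be exchanged with that of `i` without creating
an element of `F`. -/
noncomputable def exchangeable {α : Type*} [Fintype α] (F : α → α → Prop) (e i : α)
    (ρ : Equiv.Perm α) : Finset α :=
  open Classical in Finset.univ.filter fun j => j ≠ e ∧ ¬ F i (ρ j) ∧ ¬ F j (ρ i)

/-- The permutations avoiding `F`, not sending `a` to `y`, for which exchanging the values at `a`
and at the preimage of `y` creates an element of `F`. -/
noncomputable def blockedPerms {α : Type*} [Fintype α] [DecidableEq α] (F : α → α → Prop)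
    (a y : α) : Finset (Equiv.Perm α) :=
  open Classical in (avoidingPerms F).filter fun ρ => ρ a ≠ y ∧ F (ρ.symm y) (ρ a)

section Perms

open Finset Equiv

variable {α : Type*} [Fintype α] {F : α → α → Prop} {D : ℕ}

theorem mem_exchangeable {e i j : α} {ρ : Perm α} :
    j ∈ exchangeable F e i ρ ↔ j ≠ e ∧ ¬ F i (ρ j) ∧ ¬ F j (ρ i) := by
  simp [exchangeable]

theorem DegreeLE.mono {F' : α → α → Prop} (h : DegreeLE F D) (hF : ∀ i k, F' i k → F i k) :
    DegreeLE F' D := by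
  classical
  refine ⟨fun i => le_trans (card_le_card fun k => ?_) (h.1 i),
    fun k => le_trans (card_le_card fun i => ?_) (h.2 k)⟩
  · simpa using hF i k
  · simpa using hF i k

variable [DecidableEq α]

theorem mem_avoidingPerms {ρ : Perm α} : ρ ∈ avoidingPerms F ↔ ∀ i, ¬ F i (ρ i) := by
  simp [avoidingPerms]

/-- The row of `i` and the column of `ρ i` each exclude at most `D` positions, and `e` excludes one
more. -/
theorem card_le_card_exchangeable_add (h : DegreeLE F D) (e i : α) (ρ : Perm α) :
    Fintype.card α ≤ (exchangeable F e i ρ).card + (2 * D + 1) := by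
  classical
  have h1 : (univ : Finset α) ⊆ exchangeable F e i ρ ∪ ({e} ∪
      ((univ.filter fun k => F i k).image ρ.symm ∪ univ.filter fun j => F j (ρ i))) := by
    intro j _
    by_cases h1 : j = e
    · simp [h1]
    by_cases h2 : F i (ρ j)
    · simp only [mem_union, mem_image, mem_filter, mem_univ, true_and]
      exact Or.inr (Or.inr (Or.inl ⟨ρ j, h2, by simp⟩))
    by_cases h3 : F j (ρ i)
    · simp [h3]
    · simp [mem_exchangeable, h1, h2, h3]
  have h2 := card_le_card h1
  have h3 := card_union_le (exchangeable F e i ρ) ({e} ∪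
      ((univ.filter fun k => F i k).image ρ.symm ∪ univ.filter fun j => F j (ρ i)))
  have h4 := card_union_le {e}
      ((univ.filter fun k => F i k).image ρ.symm ∪ univ.filter fun j => F j (ρ i))
  have h5 := card_union_le ((univ.filter fun k => F i k).image ρ.symm)
    (univ.filter fun j => F j (ρ i))
  have h6 : ((univ.filter fun k => F i k).image ρ.symm).card ≤ _ := card_image_le
  have h7 := h.1 i
  have h8 := h.2 (ρ i)
  rw [card_singleton] at h4
  rw [card_univ] at h2
  omega

theorem mul_swap_mem_avoidingPerms {ρ : Perm α} {i j : α}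
    (hρ : ρ ∈ avoidingPerms F) (hi : ¬ F i (ρ j)) (hj : ¬ F j (ρ i)) :
    ρ * swap i j ∈ avoidingPerms F := by
  rw [mem_avoidingPerms] at hρ ⊢
  intro k
  rw [Perm.mul_apply]
  by_cases h1 : k = i
  · subst h1; rwa [swap_apply_left]
  by_cases h2 : k = j
  · subst h2; rwa [swap_apply_right]
  · rw [swap_apply_of_ne_of_ne h1 h2]; exact hρ k

/-- In a permutation with the fewest violations, exchanging a violating position with an
exchangeable one would remove a violation and create none. -/
theorem avoidingPerms_nonempty (h : DegreeLE F D) (hD : 2 * D + 2 ≤ Fintype.card α) :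
    (avoidingPerms F).Nonempty := by
  classical
  obtain ⟨ρ, -, hρ⟩ := exists_min_image (univ : Finset (Perm α))
    (fun ρ => (univ.filter fun i => F i (ρ i)).card) ⟨1, mem_univ _⟩
  refine ⟨ρ, mem_avoidingPerms.2 fun i hi => ?_⟩
  obtain ⟨j, hj⟩ : (exchangeable F i i ρ).Nonempty := by
    rw [← card_pos]
    have := card_le_card_exchangeable_add h i i ρ
    omega
  rw [mem_exchangeable] at hj
  refine absurd (hρ (ρ * swap i j) (mem_univ _)) (not_le.2 (card_lt_card ?_))
  rw [Finset.ssubset_iff_of_subset]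
  · exact ⟨i, mem_filter.2 ⟨mem_univ _, hi⟩, fun h => hj.2.1 (by simpa using (mem_filter.1 h).2)⟩
  · intro k hk
    rw [mem_filter, Perm.mul_apply] at hk
    refine mem_filter.2 ⟨mem_univ _, ?_⟩
    by_cases h1 : k = i
    · subst h1; simp [hj.2.1] at hk
    by_cases h2 : k = j
    · subst h2; simp [hj.2.2] at hk
    · rw [swap_apply_of_ne_of_ne h1 h2] at hk; exact hk.2

/-- A permutation is a product of at most as many transpositions as it moves points. -/
theorem SwapLipschitz.abs_sub_one_le {f : Perm α → ℝ} {c : ℝ} (hf : SwapLipschitz f c)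
    (hc : 0 ≤ c) (ρ : Perm α) : |f ρ - f 1| ≤ Fintype.card α * c := by
  classical
  have key : ∀ n : ℕ, ∀ ρ : Perm α, ρ.support.card ≤ n → |f ρ - f 1| ≤ n * c := by
    intro n
    induction n with
    | zero =>
      intro ρ h
      have : ρ = 1 := by simpa using h
      simp [this]
    | succ n ih =>
      intro ρ h
      by_cases h1 : ρ = 1
      · simp only [h1, sub_self, abs_zero]; positivity
      · obtain ⟨x, hx⟩ : ∃ x, ρ⁻¹ x ≠ x := by
          by_contra! hcon
          exact h1 (inv_eq_one.1 (Perm.ext hcon))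
        have h2 := Perm.card_support_swap_mul hx
        rw [Perm.support_inv] at h2
        have h3 : (ρ * swap x (ρ⁻¹ x)).support.card ≤ n := by
          rw [← Perm.support_inv, mul_inv_rev, swap_inv]
          omega
        have h4 := ih _ h3
        have h5 := hf ρ x (ρ⁻¹ x)
        rw [abs_le] at h4 h5 ⊢
        push_cast
        constructor <;> linarith [h4.1, h4.2, h5.1, h5.2]
  exact key _ ρ (card_le_univ _)

/-- The map `(ρ, b) ↦ ρ * swap a b`, with `ρ a = y` and `b` exchangeable, is a bijection onto the
unblocked permutations with `ρ a ≠ y`; its inverse swaps `a` with the preimage of `y`. The three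
errors come from non-exchangeable `b`, from the change of `f` under a swap, and from blocked
permutations. -/
theorem card_mul_exchange_sum_sub_le {a y : α} (h : DegreeLE F D) (hay : ¬ F a y)
    {f : Perm α → ℝ} {B c : ℝ} (hc : 0 ≤ c)
    (hf : SwapLipschitz f c) (hB : ∀ ρ, |f ρ| ≤ B) :
    |Fintype.card α * ∑ ρ ∈ avoidingPerms F with ρ a = y, f ρ -
        ∑ ρ ∈ avoidingPerms F with ρ a ≠ y, f ρ| ≤
      ((2 * D + 1) * B + c * Fintype.card α) * (#{ρ ∈ avoidingPerms F | ρ a = y}) +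
        B * #(blockedPerms F a y) := by
  classical
  have hB0 : 0 ≤ B := (abs_nonneg _).trans (hB 1)
  set M := {ρ ∈ avoidingPerms F | ρ a = y} with hM
  set T := M.sigma fun ρ => exchangeable F a a ρ with hT
  have e1 : ∑ x ∈ T, f x.1 = ∑ ρ ∈ M, (exchangeable F a a ρ).card * f ρ := by
    rw [hT, sum_sigma]; simp
  have e2 : ∑ x ∈ T, f (x.1 * swap a x.2) =
      ∑ ρ ∈ avoidingPerms F with ρ a ≠ y ∧ ¬ F (ρ.symm y) (ρ a), f ρ := by
    refine sum_bij' (fun x _ => x.1 * swap a x.2)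
      (fun ρ _ => ⟨ρ * swap a (ρ.symm y), ρ.symm y⟩) ?_ ?_ ?_ ?_ ?_
    · rintro ⟨ρ, b⟩ hx
      simp only [hT, hM, mem_sigma, mem_filter, mem_exchangeable] at hx ⊢
      obtain ⟨⟨h1, rfl⟩, h2, h3, h4⟩ := hx
      refine ⟨mul_swap_mem_avoidingPerms h1 h3 h4, ?_, ?_⟩
      · simpa using h2
      · have : (ρ * swap a b).symm (ρ a) = b := by
          rw [Equiv.symm_apply_eq]; simp
        rw [this]; simpa using mem_avoidingPerms.1 h1 b
    · intro ρ hx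
      simp only [hT, hM, mem_sigma, mem_filter, mem_exchangeable] at hx ⊢
      obtain ⟨h1, h2, h3⟩ := hx
      refine ⟨⟨mul_swap_mem_avoidingPerms h1 (by simpa using hay) h3, by simp⟩, ?_, ?_, ?_⟩
      · rintro h4
        exact h2 (by rw [← h4]; simp)
      · simpa using mem_avoidingPerms.1 h1 a
      · simpa using mem_avoidingPerms.1 h1 (ρ.symm y)
    · rintro ⟨ρ, b⟩ hx
      simp only [hT, hM, mem_sigma, mem_filter, mem_exchangeable] at hx
      obtain ⟨⟨h1, rfl⟩, h2, h3, h4⟩ := hx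
      have : (ρ * swap a b).symm (ρ a) = b := by
        rw [Equiv.symm_apply_eq]; simp
      simp only [this]
      simp [mul_assoc]
    · intro ρ hx
      simp [mul_assoc]
    · intro x _
      rfl
  have e3 : ∑ ρ ∈ avoidingPerms F with ρ a ≠ y, f ρ =
      ∑ ρ ∈ blockedPerms F a y, f ρ +
      ∑ x ∈ T, f (x.1 * swap a x.2) := by
    rw [e2, ← sum_filter_add_sum_filter_not _ (fun ρ => F (ρ.symm y) (ρ a)), filter_filter,
      filter_filter, blockedPerms]
  have b1 : |Fintype.card α * ∑ ρ ∈ M, f ρ - ∑ x ∈ T, f x.1| ≤ (2 * D + 1) * B * M.card := by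
    rw [e1, mul_sum, ← sum_sub_distrib, mul_comm _ (M.card : ℝ), ← nsmul_eq_mul]
    refine (abs_sum_le_sum_abs _ _).trans (sum_le_card_nsmul _ _ _ fun ρ _ => ?_)
    rw [← sub_mul, abs_mul]
    refine mul_le_mul ?_ (hB ρ) (abs_nonneg _) (by positivity)
    have h1 : (Fintype.card α : ℝ) ≤ (exchangeable F a a ρ).card + (2 * D + 1) := by
      exact_mod_cast card_le_card_exchangeable_add h a a ρ
    have h2 : ((exchangeable F a a ρ).card : ℝ) ≤ Fintype.card α := by
      exact_mod_cast card_le_univ _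
    rw [abs_le]
    constructor <;> linarith
  have b2 : |∑ x ∈ T, f x.1 - ∑ x ∈ T, f (x.1 * swap a x.2)| ≤
      c * Fintype.card α * M.card := by
    rw [← sum_sub_distrib]
    have h1 : (T.card : ℝ) ≤ M.card * Fintype.card α := by
      have : T.card ≤ M.card * Fintype.card α := by
        rw [hT, card_sigma, ← smul_eq_mul]
        exact sum_le_card_nsmul _ _ _ fun ρ _ => card_le_univ _
      exact_mod_cast this
    calc _ ≤ ∑ x ∈ T, |f x.1 - f (x.1 * swap a x.2)| := abs_sum_le_sum_abs _ _
      _ ≤ T.card • c := sum_le_card_nsmul _ _ _ fun x _ => by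
          rw [abs_sub_comm]; exact hf _ _ _
      _ = T.card * c := nsmul_eq_mul _ _
      _ ≤ M.card * Fintype.card α * c := by gcongr
      _ = _ := by ring
  have b3 : |∑ ρ ∈ blockedPerms F a y, f ρ| ≤
      B * #(blockedPerms F a y) := by
    rw [mul_comm, ← nsmul_eq_mul]
    exact (abs_sum_le_sum_abs _ _).trans (sum_le_card_nsmul _ _ _ fun ρ _ => hB ρ)
  rw [e3]
  rw [abs_le] at *
  constructor <;> linarith [b1.1, b1.2, b2.1, b2.2, b3.1, b3.2]

theorem card_fixing_mul_le {a y : α} (h : DegreeLE F D) :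
    Fintype.card α * #{ρ ∈ avoidingPerms F | ρ a = y} ≤
      #{ρ ∈ avoidingPerms F | ρ a ≠ y} + (2 * D + 1) * #{ρ ∈ avoidingPerms F | ρ a = y} := by
  classical
  set M := {ρ ∈ avoidingPerms F | ρ a = y} with hM
  have h1 : (M.sigma fun ρ => exchangeable F a a ρ).card ≤ #{ρ ∈ avoidingPerms F | ρ a ≠ y} := by
    refine card_le_card_of_injOn (fun x => x.1 * swap a x.2) ?_ ?_
    · rintro ⟨ρ, b⟩ hx
      simp only [hM, mem_coe, mem_sigma, mem_filter, mem_exchangeable] at hx ⊢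
      obtain ⟨⟨h1, rfl⟩, h2, h3, h4⟩ := hx
      exact ⟨mul_swap_mem_avoidingPerms h1 h3 h4, by simpa using h2⟩
    · rintro ⟨ρ, b⟩ hx ⟨ρ', b'⟩ hx' heq
      simp only [hM, mem_coe, mem_sigma, mem_filter, mem_exchangeable] at hx hx' heq
      have hb : b = b' := by
        have h2 : (ρ * swap a b) b = y := by simpa using hx.1.2
        have h3 : (ρ' * swap a b') b' = y := by simpa using hx'.1.2
        rw [← heq] at h3
        exact (ρ * swap a b).injective (h2.trans h3.symm)
      subst hb
      rw [mul_left_inj] at heq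
      rw [heq]
  rw [card_sigma] at h1
  have h2 : ∑ ρ ∈ M, Fintype.card α ≤
      ∑ ρ ∈ M, ((exchangeable F a a ρ).card + (2 * D + 1)) :=
    sum_le_sum fun ρ _ => card_le_card_exchangeable_add h a a ρ
  rw [sum_add_distrib, sum_const, sum_const, smul_eq_mul, smul_eq_mul] at h2
  linarith

/-- Moving `y` from its blocking position to an exchangeable `b ≠ a` keeps `ρ a`. The new
permutation together with the old position of `y` determines `(ρ, b)`, and that position is one of
at most `D` in the column of `ρ a`. -/
theorem card_blockedPerms_mul_le {a y : α} (h : DegreeLE F D) :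
    Fintype.card α * #(blockedPerms F a y) ≤
      D * #{ρ ∈ avoidingPerms F | ρ a ≠ y} +
        (2 * D + 1) * #(blockedPerms F a y) := by
  classical
  set M := blockedPerms F a y with hM
  set N := {ρ ∈ avoidingPerms F | ρ a ≠ y} with hN
  have h1 : (M.sigma fun ρ => exchangeable F a (ρ.symm y) ρ).card ≤
      (N.sigma fun ρ => univ.filter fun b => F b (ρ a)).card := by
    refine card_le_card_of_injOn
      (fun x => ⟨x.1 * swap (x.1.symm y) x.2, x.1.symm y⟩) ?_ ?_
    · rintro ⟨ρ, b⟩ hx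
      simp only [hM, hN, blockedPerms, mem_coe, mem_sigma, mem_filter, mem_exchangeable, mem_univ,
        true_and] at hx ⊢
      obtain ⟨⟨h1, h5, h6⟩, h2, h3, h4⟩ := hx
      have h7 : a ≠ ρ.symm y := fun h => h5 (by rw [h]; simp)
      have h8 : (ρ * swap (ρ.symm y) b) a = ρ a := by
        rw [Perm.mul_apply, swap_apply_of_ne_of_ne h7 h2.symm]
      rw [h8]
      exact ⟨⟨mul_swap_mem_avoidingPerms h1 h3 h4, h5⟩, h6⟩
    · rintro ⟨ρ, b⟩ hx ⟨ρ', b'⟩ hx' heq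
      simp only [Sigma.mk.injEq, heq_eq_eq] at heq
      obtain ⟨h2, h3⟩ := heq
      have hb : b = b' := by
        have h4 : (ρ * swap (ρ.symm y) b) b = y := by simp
        have h5 : (ρ' * swap (ρ'.symm y) b') b' = y := by simp
        rw [← h2] at h5
        exact (ρ * swap (ρ.symm y) b).injective (h4.trans h5.symm)
      subst hb
      rw [h3, mul_left_inj] at h2
      rw [h2]
  rw [card_sigma, card_sigma] at h1
  have h2 : ∑ ρ ∈ M, Fintype.card α ≤
      ∑ ρ ∈ M, ((exchangeable F a (ρ.symm y) ρ).card + (2 * D + 1)) :=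
    sum_le_sum fun ρ _ => card_le_card_exchangeable_add h a _ ρ
  have h3 : ∑ ρ ∈ N, #{b | F b (ρ a)} ≤ N.card • D :=
    sum_le_card_nsmul _ _ _ fun ρ _ => by convert h.2 (ρ a)
  rw [sum_add_distrib, sum_const, sum_const, smul_eq_mul, smul_eq_mul] at h2
  rw [smul_eq_mul] at h3
  linarith

theorem finsetAvg_sub_const {β : Type*} {s : Finset β} (hs : s.Nonempty) (f : β → ℝ) (r : ℝ) :
    finsetAvg s (fun x => f x - r) = finsetAvg s f - r := by
  have : (s.card : ℝ) ≠ 0 := by exact_mod_cast hs.card_pos.ne'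
  rw [finsetAvg, finsetAvg, sum_sub_distrib, sum_const, nsmul_eq_mul]
  field_simp

theorem abs_finsetAvg_avoiding_sub_le_of_bounded {a y : α} (h : DegreeLE F D) (hay : ¬ F a y)
    (hD1 : 1 ≤ D) (hD : 6 * D ≤ Fintype.card α) {f : Perm α → ℝ} {c : ℝ} (hc : 0 ≤ c)
    (hf : SwapLipschitz f c) (hB : ∀ ρ, |f ρ| ≤ Fintype.card α * c)
    (hne : ({ρ ∈ avoidingPerms F | ρ a ≠ y} : Finset _).Nonempty) :
    |finsetAvg (avoidingPerms F) f - finsetAvg {ρ ∈ avoidingPerms F | ρ a ≠ y} f| ≤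
      36 * D / Fintype.card α * c := by
  have k1 := card_mul_exchange_sum_sub_le h hay hc hf hB
  -- The constant function turns the exchange estimate into a comparison of cardinalities.
  have k2 := card_mul_exchange_sum_sub_le h hay le_rfl (f := fun _ => 1) (B := 1)
    (fun _ _ _ => by simp) (fun _ => by simp)
  have k3 := card_fixing_mul_le (a := a) (y := y) h
  have k4 := card_blockedPerms_mul_le (a := a) (y := y) h
  rw [finsetAvg, finsetAvg, ← sum_filter_add_sum_filter_not (avoidingPerms F) (fun ρ => ρ a = y),
    ← card_filter_add_card_filter_not (s := avoidingPerms F) (fun ρ => ρ a = y)]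
  have k5 : |∑ ρ ∈ avoidingPerms F with ρ a = y, f ρ| ≤
      #{ρ ∈ avoidingPerms F | ρ a = y} * (Fintype.card α * c) := by
    rw [← nsmul_eq_mul]
    exact (abs_sum_le_sum_abs _ _).trans (sum_le_card_nsmul _ _ _ fun ρ _ => hB ρ)
  have k6 : (0 : ℝ) < #{ρ ∈ avoidingPerms F | ρ a ≠ y} := by exact_mod_cast hne.card_pos
  simp only [sum_const, nsmul_eq_mul, mul_one, zero_mul, add_zero, one_mul] at k2
  have k3' : (Fintype.card α : ℝ) * #{ρ ∈ avoidingPerms F | ρ a = y} ≤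
      #{ρ ∈ avoidingPerms F | ρ a ≠ y} + (2 * D + 1) * #{ρ ∈ avoidingPerms F | ρ a = y} := by
    exact_mod_cast k3
  have k4' : (Fintype.card α : ℝ) * #(blockedPerms F a y) ≤
      D * #{ρ ∈ avoidingPerms F | ρ a ≠ y} + (2 * D + 1) * #(blockedPerms F a y) := by
    exact_mod_cast k4
  have hD1' : (1 : ℝ) ≤ D := by exact_mod_cast hD1
  have hD' : 6 * (D : ℝ) ≤ Fintype.card α := by exact_mod_cast hD
  have hp : (0 : ℝ) ≤ #{ρ ∈ avoidingPerms F | ρ a = y} := by positivity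
  have hb : (0 : ℝ) ≤ #(blockedPerms F a y) := by positivity
  push_cast
  simp only [← ne_eq]
  generalize (#{ρ ∈ avoidingPerms F | ρ a = y} : ℝ) = p at *
  generalize (#{ρ ∈ avoidingPerms F | ρ a ≠ y} : ℝ) = m at *
  generalize (#(blockedPerms F a y) : ℝ) = b at *
  generalize ∑ ρ ∈ avoidingPerms F with ρ a = y, f ρ = s at *
  generalize ∑ ρ ∈ avoidingPerms F with ρ a ≠ y, f ρ = t at *
  generalize (Fintype.card α : ℝ) = q at *
  generalize (D : ℝ) = d at *
  have hq : 0 < q := by linarith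
  -- Since `1 ≤ d` and `6 * d ≤ q`, the loss `2 * d + 1` is at most `q / 2`.
  have p1 : q * p ≤ 2 * m := by
    nlinarith [mul_nonneg (by linarith : 0 ≤ q - 2 * (2 * d + 1)) hp]
  have p2 : q * b ≤ 2 * d * m := by
    nlinarith [mul_nonneg (by linarith : 0 ≤ q - 2 * (2 * d + 1)) hb]
  -- The numerator `s * m - t * p` is rewritten through the two quantities already known to be
  -- small, `q * s - t` and `q * p - m`.
  have e : (s + t) / (p + m) - t / m = (p * (q * s - t) - s * (q * p - m)) / ((p + m) * m) := by
    have : p + m ≠ 0 := by positivity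
    field_simp
    ring
  rw [e, abs_div, abs_of_pos (by positivity : 0 < (p + m) * m), div_le_iff₀ (by positivity)]
  have h1 : |p * (q * s - t) - s * (q * p - m)| ≤
      p * (((2 * d + 1) * (q * c) + c * q) * p + q * c * b) + p * (q * c) * ((2 * d + 1) * p + b) := by
    refine (abs_sub _ _).trans ?_
    rw [abs_mul, abs_mul, abs_of_nonneg hp]
    gcongr
  refine h1.trans ?_
  have h2 : p * (((2 * d + 1) * (q * c) + c * q) * p + q * c * b) +
      p * (q * c) * ((2 * d + 1) * p + b) =
      (p * c) * ((4 * d + 3) * (q * p) + 2 * (q * b)) := by ring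
  rw [h2]
  have h3 : (4 * d + 3) * (q * p) + 2 * (q * b) ≤ 18 * d * m := by nlinarith
  calc _ ≤ p * c * (18 * d * m) := by gcongr
    _ = 18 * d * m * c * (q * p) / q := by field_simp
    _ ≤ 18 * d * m * c * (2 * m) / q := by gcongr
    _ = 36 * d / q * c * (m * m) := by ring
    _ ≤ _ := by gcongr; linarith

theorem abs_finsetAvg_avoiding_sub_le {F' : α → α → Prop} (h : DegreeLE F' D)
    (hD1 : 1 ≤ D) (hD : 6 * D ≤ Fintype.card α) {f : Perm α → ℝ} {c : ℝ} (hc : 0 ≤ c)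
    (hf : SwapLipschitz f c) {a : α} (hsub : ∀ i k, F i k → F' i k)
    (hrow : ∀ i k, F' i k → ¬ F i k → i = a)
    (huniq : ∀ k l, F' a k → ¬ F a k → F' a l → ¬ F a l → k = l) :
    |finsetAvg (avoidingPerms F) f - finsetAvg (avoidingPerms F') f| ≤
      36 * D / Fintype.card α * c := by
  by_cases hex : ∃ y, F' a y ∧ ¬ F a y
  · obtain ⟨y, hy', hy⟩ := hex
    have e : avoidingPerms F' = {ρ ∈ avoidingPerms F | ρ a ≠ y} := by
      ext ρ
      simp only [mem_avoidingPerms, mem_filter]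
      constructor
      · intro h1
        exact ⟨fun i hi => h1 i (hsub _ _ hi), fun h2 => h1 a (h2 ▸ hy')⟩
      · rintro ⟨h1, h2⟩ i hi
        have h3 := hrow _ _ hi (h1 i)
        subst h3
        exact h2 (huniq _ _ hi (h1 i) hy' hy)
    have hne' : (avoidingPerms F').Nonempty := avoidingPerms_nonempty h (by omega)
    have hF := h.mono hsub
    have hne : (avoidingPerms F).Nonempty := avoidingPerms_nonempty hF (by omega)
    -- Subtracting `f 1` does not affect the difference of averages and supplies the sup bound.
    have := abs_finsetAvg_avoiding_sub_le_of_bounded hF hy hD1 hD hc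
      (f := fun ρ => f ρ - f 1) (fun ρ i j => by simpa using hf ρ i j)
      (fun ρ => hf.abs_sub_one_le hc ρ) (e ▸ hne')
    rw [← e, finsetAvg_sub_const hne, finsetAvg_sub_const hne'] at this
    simpa using this
  · have e : F = F' := by
      ext i k
      refine ⟨hsub i k, fun h1 => ?_⟩
      by_contra h2
      have := hrow i k h1 h2
      subst this
      exact hex ⟨k, h1, h2⟩
    rw [e, sub_self, abs_zero]
    positivity

end Perms

/-! ### Contraction of the heat-bath operator. -/

/-- Giving the `k`-th colour at `u` to the `i`-th colouring conflicts with a neighbour of `u`. -/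
def ColorConflict {V α : Type*} (G : SimpleGraph V) (col : V → α → ℕ) (ω : V → Equiv.Perm α)
    (u : V) (i k : α) : Prop :=
  ∃ w, G.Adj u w ∧ col u k = col w (ω w i)

/-- The expectation of `f` after resampling `ω u` uniformly among the permutations without conflict
with the neighbours of `u`; unlike in the Glauber dynamics, `ω` need not be a packing. -/
noncomputable def resampleAvg {V α : Type*} [DecidableEq V] [Fintype α] [DecidableEq α]
    (G : SimpleGraph V) (col : V → α → ℕ) (u : V) (f : (V → Equiv.Perm α) → ℝ)
    (ω : V → Equiv.Perm α) : ℝ :=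
  finsetAvg (avoidingPerms (ColorConflict G col ω u)) fun ρ => f (Function.update ω u ρ)

/-- The heat-bath operator on functions of arbitrary families of permutations. -/
noncomputable def heatBath {V α : Type*} [Fintype V] [DecidableEq V] [Fintype α] [DecidableEq α]
    (G : SimpleGraph V) (col : V → α → ℕ) (f : (V → Equiv.Perm α) → ℝ)
    (ω : V → Equiv.Perm α) : ℝ :=
  (∑ u, resampleAvg G col u f ω) / Fintype.card V

/-- A transposition at a single vertex changes `f` by at most `c`. -/
def SiteLipschitz {V α : Type*} [DecidableEq V] [DecidableEq α] (f : (V → Equiv.Perm α) → ℝ)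
    (c : ℝ) : Prop :=
  ∀ ω v, SwapLipschitz (fun ρ => f (Function.update ω v ρ)) c

section HeatBath

open Finset Equiv

variable {V α : Type*} {G : SimpleGraph V} {col : V → α → ℕ}

/-- By injectivity of the colour lists and of `ω w`, each neighbour `w` adds at most one pair to any
row or column. -/
theorem degreeLE_colorConflict [Fintype V] [DecidableRel G.Adj] [Fintype α] {D : ℕ}
    (hcol : ∀ v, Function.Injective (col v)) (hdeg : ∀ v, G.degree v ≤ D)
    (ω : V → Perm α) (u : V) : DegreeLE (ColorConflict G col ω u) D := by
  classical
  constructor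
  · intro i
    have h : (univ.filter fun k => ColorConflict G col ω u i k) ⊆
        (G.neighborFinset u).biUnion fun w => univ.filter fun k => col u k = col w (ω w i) := by
      intro k hk
      obtain ⟨w, h1, h2⟩ := (mem_filter.1 hk).2
      exact mem_biUnion.2 ⟨w, by simpa using h1, mem_filter.2 ⟨mem_univ _, h2⟩⟩
    refine (card_le_card h).trans ((card_biUnion_le_card_mul _ _ 1 fun w _ => ?_).trans ?_)
    · exact card_le_one.2 fun x hx y hy => hcol u
        ((mem_filter.1 hx).2.trans (mem_filter.1 hy).2.symm)
    · simpa using hdeg u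
  · intro k
    have h : (univ.filter fun i => ColorConflict G col ω u i k) ⊆
        (G.neighborFinset u).biUnion fun w => univ.filter fun i => col u k = col w (ω w i) := by
      intro k hk
      obtain ⟨w, h1, h2⟩ := (mem_filter.1 hk).2
      exact mem_biUnion.2 ⟨w, by simpa using h1, mem_filter.2 ⟨mem_univ _, h2⟩⟩
    refine (card_le_card h).trans ((card_biUnion_le_card_mul _ _ 1 fun w _ => ?_).trans ?_)
    · exact card_le_one.2 fun x hx y hy => (ω w).injective (hcol w
        ((mem_filter.1 hx).2.symm.trans (mem_filter.1 hy).2))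
    · simpa using hdeg u

variable [DecidableEq V]

theorem colorConflict_update_of_not_adj {ω : V → Perm α} {u v : V} (h : ¬ G.Adj u v)
    (ρ : Perm α) : ColorConflict G col (Function.update ω v ρ) u = ColorConflict G col ω u := by
  ext i k
  refine exists_congr fun w => and_congr_right fun hw => ?_
  rw [Function.update_of_ne]
  rintro rfl
  exact h hw

theorem abs_finsetAvg_sub_le {β : Type*} {s : Finset β} {f g : β → ℝ} {c : ℝ}
    (hc : 0 ≤ c) (h : ∀ x ∈ s, |f x - g x| ≤ c) : |finsetAvg s f - finsetAvg s g| ≤ c := by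
  rw [finsetAvg, finsetAvg, ← sub_div, ← sum_sub_distrib, abs_div, Nat.abs_cast]
  refine div_le_of_le_mul₀ (by positivity) hc ?_
  rw [mul_comm, ← nsmul_eq_mul]
  exact (abs_sum_le_sum_abs _ _).trans (sum_le_card_nsmul _ _ _ h)

variable [DecidableEq α]

theorem SiteLipschitz.abs_update_update_sub_le {f : (V → Perm α) → ℝ} {c : ℝ}
    (hf : SiteLipschitz f c) (ω : V → Perm α) {u v : V} (huv : u ≠ v) (σ ρ : Perm α) (i j : α) :
    |f (Function.update (Function.update ω v (σ * swap i j)) u ρ) -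
      f (Function.update (Function.update ω v σ) u ρ)| ≤ c := by
  rw [Function.update_comm huv.symm, Function.update_comm huv.symm]
  exact hf (Function.update ω u ρ) v σ i j

variable [Fintype α]

theorem resampleAvg_update_eq {f : (V → Perm α) → ℝ} (ω : V → Perm α) (v : V) (σ τ : Perm α) :
    resampleAvg G col v f (Function.update ω v σ) =
      resampleAvg G col v f (Function.update ω v τ) := by
  simp only [resampleAvg, Function.update_idem]
  rw [colorConflict_update_of_not_adj (G.loopless.irrefl v),
    colorConflict_update_of_not_adj (G.loopless.irrefl v)]

theorem abs_resampleAvg_sub_le_of_not_adj {f : (V → Perm α) → ℝ} {c : ℝ} (hc : 0 ≤ c)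
    (hf : SiteLipschitz f c) (ω : V → Perm α) {u v : V} (huv : u ≠ v) (hadj : ¬ G.Adj u v)
    (σ : Perm α) (i j : α) :
    |resampleAvg G col u f (Function.update ω v (σ * swap i j)) -
      resampleAvg G col u f (Function.update ω v σ)| ≤ c := by
  simp only [resampleAvg]
  rw [colorConflict_update_of_not_adj hadj, colorConflict_update_of_not_adj hadj]
  exact abs_finsetAvg_sub_le hc fun ρ _ => hf.abs_update_update_sub_le ω huv σ ρ i j

variable [Fintype V] [DecidableRel G.Adj] {D : ℕ}

/-- Erasing the conflicts caused by `v` in rows `i` and `j` removes at most one pair per row, so the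
one-pair estimate applies twice. -/
theorem abs_finsetAvg_colorConflict_erase_le (hcol : ∀ v, Function.Injective (col v))
    (hdeg : ∀ v, G.degree v ≤ D) (hD1 : 1 ≤ D) (hD : 6 * D ≤ Fintype.card α)
    {g : Perm α → ℝ} {c : ℝ} (hc : 0 ≤ c) (hg : SwapLipschitz g c) (ω : V → Perm α) (u v : V)
    (i j : α) :
    |finsetAvg (avoidingPerms fun l k =>
        ∃ w, G.Adj u w ∧ col u k = col w (ω w l) ∧ (w = v → l ≠ i ∧ l ≠ j)) g -
      finsetAvg (avoidingPerms (ColorConflict G col ω u)) g| ≤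
      72 * D / Fintype.card α * c := by
  have hd := degreeLE_colorConflict hcol hdeg ω u
  have h1 := abs_finsetAvg_avoiding_sub_le
    (F := fun l k => ∃ w, G.Adj u w ∧ col u k = col w (ω w l) ∧ (w = v → l ≠ i))
    hd hD1 hD hc hg (a := i) (fun l k ⟨w, h1, h2, _⟩ => ⟨w, h1, h2⟩)
    (fun l k ⟨w, h1, h2⟩ h3 => by
      by_contra h4
      exact h3 ⟨w, h1, h2, fun _ => h4⟩)
    (fun k l ⟨w, h1, h2⟩ h3 ⟨w', h4, h5⟩ h6 => by
      have e1 : w = v := by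
        by_contra h7
        exact h3 ⟨w, h1, h2, fun h8 => absurd h8 h7⟩
      have e2 : w' = v := by
        by_contra h7
        exact h6 ⟨w', h4, h5, fun h8 => absurd h8 h7⟩
      subst e1 e2
      exact hcol u (h2.trans h5.symm))
  have h2 := abs_finsetAvg_avoiding_sub_le
    (F := fun l k => ∃ w, G.Adj u w ∧ col u k = col w (ω w l) ∧ (w = v → l ≠ i ∧ l ≠ j))
    (F' := fun l k => ∃ w, G.Adj u w ∧ col u k = col w (ω w l) ∧ (w = v → l ≠ i))
    (hd.mono fun l k ⟨w, h1, h2, _⟩ => ⟨w, h1, h2⟩) hD1 hD hc hg (a := j)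
    (fun l k ⟨w, h1, h2, h3⟩ => ⟨w, h1, h2, fun h => (h3 h).1⟩)
    (fun l k ⟨w, h1, h2, h5⟩ h3 => by
      by_contra h4
      exact h3 ⟨w, h1, h2, fun h => ⟨h5 h, h4⟩⟩)
    (fun k l ⟨w, h1, h2, _⟩ h3 ⟨w', h4, h5, _⟩ h6 => by
      have e1 : w = v := by
        by_contra h7
        exact h3 ⟨w, h1, h2, fun h8 => absurd h8 h7⟩
      have e2 : w' = v := by
        by_contra h7
        exact h6 ⟨w', h4, h5, fun h8 => absurd h8 h7⟩
      subst e1 e2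
      exact hcol u (h2.trans h5.symm))
  refine (abs_sub_le _ _ _).trans ((add_le_add h2 h1).trans (le_of_eq ?_))
  ring

/-- Both averages are compared with the one over the erased relation, which is the same before and
after the transposition. -/
theorem abs_resampleAvg_sub_le_of_adj (hcol : ∀ v, Function.Injective (col v))
    (hdeg : ∀ v, G.degree v ≤ D) (hD1 : 1 ≤ D) (hD : 6 * D ≤ Fintype.card α)
    {f : (V → Perm α) → ℝ} {c : ℝ} (hc : 0 ≤ c)
    (hf : SiteLipschitz f c) (ω : V → Perm α) {u v : V} (huv : u ≠ v)
    (σ : Perm α) (i j : α) :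
    |resampleAvg G col u f (Function.update ω v (σ * swap i j)) -
      resampleAvg G col u f (Function.update ω v σ)| ≤ c + 144 * D / Fintype.card α * c := by
  have h1 := abs_finsetAvg_colorConflict_erase_le hcol hdeg hD1 hD hc
    (hf (Function.update ω v σ) u) (Function.update ω v σ) u v i j
  have h2 := abs_finsetAvg_colorConflict_erase_le hcol hdeg hD1 hD hc
    (hf (Function.update ω v σ) u) (Function.update ω v (σ * swap i j)) u v i j
  have h3 : (fun l k => ∃ w, G.Adj u w ∧ col u k = col w (Function.update ω v (σ * swap i j) w l) ∧
      (w = v → l ≠ i ∧ l ≠ j)) = (fun l k => ∃ w, G.Adj u w ∧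
        col u k = col w (Function.update ω v σ w l) ∧ (w = v → l ≠ i ∧ l ≠ j)) := by
    ext l k
    refine exists_congr fun w => and_congr_right fun _ => and_congr_left fun h => ?_
    by_cases hw : w = v
    · subst hw
      simp [swap_apply_of_ne_of_ne (h rfl).1 (h rfl).2]
    · simp [Function.update_of_ne hw]
  rw [h3] at h2
  have h4 : |resampleAvg G col u f (Function.update ω v (σ * swap i j)) -
      finsetAvg (avoidingPerms (ColorConflict G col (Function.update ω v (σ * swap i j)) u))
        fun ρ => f (Function.update (Function.update ω v σ) u ρ)| ≤ c :=
    abs_finsetAvg_sub_le hc fun ρ _ => hf.abs_update_update_sub_le ω huv σ ρ i j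
  rw [abs_sub_comm] at h2
  have h5 : 144 * D / Fintype.card α * c = 2 * (72 * D / Fintype.card α * c) := by ring
  rw [h5]
  refine (abs_sub_le _ _ _).trans (add_le_add h4 ((abs_sub_le _ _ _).trans
    ((add_le_add h2 h1).trans (by linarith))))

theorem SiteLipschitz.heatBath [Nonempty V] (hcol : ∀ v, Function.Injective (col v))
    (hdeg : ∀ v, G.degree v ≤ D) (hD1 : 1 ≤ D) (hD : 288 * D ^ 2 ≤ Fintype.card α)
    {f : (V → Perm α) → ℝ} {c : ℝ} (hc : 0 ≤ c) (hf : SiteLipschitz f c) :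
    SiteLipschitz (heatBath G col f) ((1 - 1 / (2 * Fintype.card V)) * c) := by
  classical
  intro ω v σ i j
  have hn : (0 : ℝ) < Fintype.card V := by exact_mod_cast Fintype.card_pos
  have hD6 : 6 * D ≤ Fintype.card α := by nlinarith
  have hq : (0 : ℝ) < Fintype.card α := by
    have : 0 < Fintype.card α := by omega
    exact_mod_cast this
  have hD' : 288 * (D : ℝ) ^ 2 ≤ Fintype.card α := by exact_mod_cast hD
  have hbound : ∀ u, |resampleAvg G col u f (Function.update ω v (σ * swap i j)) -
      resampleAvg G col u f (Function.update ω v σ)| ≤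
      (c - if u = v then c else 0) +
        if u ∈ G.neighborFinset v then 144 * D / Fintype.card α * c else 0 := by
    intro u
    by_cases h1 : u = v
    · subst h1
      rw [resampleAvg_update_eq ω u _ σ]
      simp
    · by_cases h2 : G.Adj u v
      · have h3 : u ∈ G.neighborFinset v := by simpa using h2.symm
        rw [if_neg h1, if_pos h3, sub_zero]
        exact abs_resampleAvg_sub_le_of_adj hcol hdeg hD1 hD6 hc hf ω h1 σ i j
      · have h3 : u ∉ G.neighborFinset v := by simpa [G.adj_comm] using h2
        rw [if_neg h1, if_neg h3, sub_zero, add_zero]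
        exact abs_resampleAvg_sub_le_of_not_adj hc hf ω h1 h2 σ i j
  have hsum : |∑ u, resampleAvg G col u f (Function.update ω v (σ * swap i j)) -
      ∑ u, resampleAvg G col u f (Function.update ω v σ)| ≤
      Fintype.card V * c - c + G.degree v * (144 * D / Fintype.card α * c) := by
    rw [← sum_sub_distrib]
    refine (abs_sum_le_sum_abs _ _).trans ((sum_le_sum fun u _ => hbound u).trans (le_of_eq ?_))
    rw [sum_add_distrib, sum_sub_distrib, sum_ite_eq' univ v, ← sum_filter, sum_const, sum_const,
      nsmul_eq_mul, nsmul_eq_mul, filter_mem_eq_inter, univ_inter,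
      SimpleGraph.card_neighborFinset_eq_degree]
    simp
  -- The constant 288 is chosen here, so that the neighbours consume only half of the gain at `v`.
  have hsmall : G.degree v * (144 * D / Fintype.card α * c) ≤ c / 2 := by
    have h1 : (G.degree v : ℝ) ≤ D := by exact_mod_cast hdeg v
    calc G.degree v * (144 * D / Fintype.card α * c) ≤ D * (144 * D / Fintype.card α * c) := by
          gcongr
      _ = 288 * D ^ 2 / Fintype.card α * (c / 2) := by ring
      _ ≤ 1 * (c / 2) := by
          gcongr
          rwa [div_le_one hq]
      _ = _ := one_mul _
  simp only [_root_.heatBath]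
  rw [← sub_div, abs_div, abs_of_pos hn, div_le_iff₀ hn]
  refine hsum.trans ?_
  have : (1 - 1 / (2 * (Fintype.card V : ℝ))) * c * Fintype.card V =
      Fintype.card V * c - c / 2 := by
    field_simp
  linarith

/-- Vertices are changed one at a time; the factor 2 comes from passing through the identity
permutation at each. -/
theorem SiteLipschitz.abs_sub_le {f : (V → Perm α) → ℝ} {c : ℝ} (hc : 0 ≤ c)
    (hf : SiteLipschitz f c) (ω ω' : V → Perm α) :
    |f ω - f ω'| ≤ 2 * (Fintype.card V * (Fintype.card α * c)) := by
  have key : ∀ s : Finset V, |f (fun v => if v ∈ s then ω v else ω' v) - f ω'| ≤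
      s.card * (2 * (Fintype.card α * c)) := by
    intro s
    induction s using Finset.induction_on with
    | empty => simp
    | insert v s hv ih =>
      have e1 : (fun w => if w ∈ insert v s then ω w else ω' w) =
          Function.update (fun w => if w ∈ s then ω w else ω' w) v (ω v) := by
        ext w
        by_cases h : w = v
        · subst h; simp
        · simp [h]
      have e2 : (fun w => if w ∈ s then ω w else ω' w) =
          Function.update (fun w => if w ∈ s then ω w else ω' w) v (ω' v) := by
        rw [Function.eq_update_iff]
        simp [hv]
      have h1 := (hf (fun w => if w ∈ s then ω w else ω' w) v).abs_sub_one_le hc (ω v)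
      have h2 := (hf (fun w => if w ∈ s then ω w else ω' w) v).abs_sub_one_le hc (ω' v)
      rw [← e1] at h1
      rw [← e2] at h2
      rw [card_insert_of_notMem hv]
      push_cast
      rw [abs_le] at *
      constructor <;> linarith [h1.1, h1.2, h2.1, h2.2, ih.1, ih.2]
  have := key univ
  simp only [mem_univ, if_true, card_univ] at this
  linarith

theorem SiteLipschitz.iterate_heatBath [Nonempty V] (hcol : ∀ v, Function.Injective (col v))
    (hdeg : ∀ v, G.degree v ≤ D) (hD1 : 1 ≤ D) (hD : 288 * D ^ 2 ≤ Fintype.card α)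
    {f : (V → Perm α) → ℝ} {c : ℝ} (hc : 0 ≤ c) (hf : SiteLipschitz f c) (t : ℕ) :
    SiteLipschitz ((_root_.heatBath G col)^[t] f) ((1 - 1 / (2 * Fintype.card V)) ^ t * c) := by
  have hn : (1 : ℝ) ≤ Fintype.card V := by exact_mod_cast Fintype.card_pos
  have h0 : (0 : ℝ) ≤ 1 - 1 / (2 * Fintype.card V) := by
    rw [sub_nonneg, div_le_one (by positivity)]
    linarith
  induction t with
  | zero => simpa using hf
  | succ t ih =>
    rw [Function.iterate_succ_apply', pow_succ', mul_assoc]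
    exact ih.heatBath hcol hdeg hD1 hD (by positivity)

end HeatBath

/-! ### Expectations and total variation on finite spaces. -/

/-- The expectation of `f` under the distribution `p` on a finite space. -/
noncomputable def pmfExp {β : Type*} [Fintype β] (p : PMF β) (f : β → ℝ) : ℝ :=
  ∑ x, (p x).toReal * f x

section Expectation

open Finset

variable {β γ : Type*} [Fintype β] [Fintype γ]

theorem PMF.sum_toReal (p : PMF β) : ∑ x, (p x).toReal = 1 := by
  rw [← ENNReal.toReal_sum fun x _ => p.apply_ne_top x, ← tsum_fintype (L := .unconditional _),
    p.tsum_coe, ENNReal.toReal_one]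

theorem pmfExp_bind (p : PMF β) (P : β → PMF γ) (f : γ → ℝ) :
    pmfExp (p.bind P) f = pmfExp p fun x => pmfExp (P x) f := by
  simp only [pmfExp, mul_sum]
  rw [sum_comm]
  refine sum_congr rfl fun y _ => ?_
  rw [PMF.bind_apply, tsum_fintype, ENNReal.toReal_sum, sum_mul]
  · refine sum_congr rfl fun x _ => ?_
    rw [ENNReal.toReal_mul, mul_assoc]
  · exact fun x _ => ENNReal.mul_ne_top (p.apply_ne_top x) ((P x).apply_ne_top y)

theorem pmfExp_pure (x : β) (f : β → ℝ) : pmfExp (PMF.pure x) f = f x := by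
  classical
  simp only [pmfExp, PMF.pure_apply]
  rw [sum_eq_single x]
  · simp
  · intro y _ h
    simp [h]
  · simp

theorem pmfExp_map (p : PMF β) (g : β → γ) (f : γ → ℝ) :
    pmfExp (p.map g) f = pmfExp p fun x => f (g x) := by
  rw [← PMF.bind_pure_comp, pmfExp_bind]
  simp only [Function.comp_apply, pmfExp_pure]

theorem pmfExp_uniformOfFintype [Nonempty β] (f : β → ℝ) :
    pmfExp (PMF.uniformOfFintype β) f = (∑ x, f x) / Fintype.card β := by
  simp only [pmfExp, PMF.uniformOfFintype_apply, ENNReal.toReal_inv, ENNReal.toReal_natCast]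
  rw [← mul_sum, div_eq_inv_mul]

theorem pmfExp_le {p : PMF β} {f : β → ℝ} {b : ℝ} (h : ∀ x, f x ≤ b) : pmfExp p f ≤ b := by
  calc pmfExp p f ≤ ∑ x, (p x).toReal * b :=
        sum_le_sum fun x _ => mul_le_mul_of_nonneg_left (h x) ENNReal.toReal_nonneg
    _ = b := by rw [← sum_mul, p.sum_toReal, one_mul]

theorem le_pmfExp {p : PMF β} {f : β → ℝ} {b : ℝ} (h : ∀ x, b ≤ f x) : b ≤ pmfExp p f := by
  calc b = ∑ x, (p x).toReal * b := by rw [← sum_mul, p.sum_toReal, one_mul]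
    _ ≤ pmfExp p f :=
        sum_le_sum fun x _ => mul_le_mul_of_nonneg_left (h x) ENNReal.toReal_nonneg

theorem pmfExp_sub_le {p p' : PMF β} {f : β → ℝ} {b : ℝ} (h : ∀ x y, f x - f y ≤ b) :
    pmfExp p f - pmfExp p' f ≤ b := by
  have : pmfExp p f - b ≤ pmfExp p' f := le_pmfExp fun y => by
    have : pmfExp p f ≤ f y + b := pmfExp_le fun x => by linarith [h x y]
    linarith
  linarith

theorem tvDistance_eq_pmfExp_sign (p p' : PMF β) :
    tvDistance p p' = 1 / 2 *
      (pmfExp p (fun x => if (p' x).toReal ≤ (p x).toReal then 1 else -1) -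
        pmfExp p' (fun x => if (p' x).toReal ≤ (p x).toReal then 1 else -1)) := by
  rw [tvDistance, pmfExp, pmfExp, ← sum_sub_distrib]
  congr 1
  refine sum_congr rfl fun x _ => ?_
  split_ifs with h
  · rw [abs_of_nonneg (by linarith)]; ring
  · rw [abs_of_neg (by linarith)]; ring

theorem eq_of_tvDistance_le_zero {p p' : PMF β} (h : tvDistance p p' ≤ 0) : p = p' := by
  have h1 : ∑ x, |(p x).toReal - (p' x).toReal| = 0 := by
    refine le_antisymm ?_ (sum_nonneg fun _ _ => abs_nonneg _)
    rw [tvDistance] at h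
    linarith
  rw [sum_eq_zero_iff_of_nonneg fun _ _ => abs_nonneg _] at h1
  ext x
  have h2 := h1 x (mem_univ x)
  rw [abs_eq_zero, sub_eq_zero] at h2
  exact (ENNReal.toReal_eq_toReal_iff' (p.apply_ne_top x) (p'.apply_ne_top x)).1 h2

theorem distAfter_of_isStationaryDist {Ω : Type*} {P : Ω → PMF Ω} {π : PMF Ω}
    (h : IsStationaryDist P π) (t : ℕ) : distAfter P π t = π := by
  induction t with
  | zero => rfl
  | succ t ih => rw [distAfter, ih]; exact h

theorem isStationaryDist_of_symmetric {Ω : Type*} {P : Ω → PMF Ω} {π : PMF Ω}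
    (hP : ∀ x y, P x y = P y x) {c : ℝ≥0∞} (hπ : ∀ x, π x = c) : IsStationaryDist P π := by
  ext y
  simp only [PMF.bind_apply, hπ, hP _ y]
  rw [ENNReal.tsum_mul_left, (P y).tsum_coe, mul_one]

end Expectation

/-! ### The Glauber dynamics on packings. -/

section Packings

open Finset Equiv

variable {V : Type*} {G : SimpleGraph V}

/-- List membership and disjointness are automatic in the encoding, so only properness is a
condition. -/
theorem isListPacking_coloringsOf_iff {q : ℕ} {L : V → Finset ℕ} {hL : ∀ v, (L v).card = q}
    {ω : V → Perm (Fin q)} : IsListPacking G L (coloringsOf L hL ω) ↔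
      ∀ u i, ¬ ColorConflict G (fun v => (L v).orderEmbOfFin (hL v)) ω u i (ω u i) := by
  constructor
  · rintro ⟨h, -⟩ u i ⟨w, h1, h2⟩
    exact (h i).1 u w h1 h2
  · intro h
    refine ⟨fun i => ⟨fun u w h1 h2 => h u i ⟨w, h1, h2⟩, fun v => orderEmbOfFin_mem _ _ _⟩, ?_⟩
    intro i j hij v h1
    exact hij ((ω v).injective (((L v).orderEmbOfFin (hL v)).injective h1))

variable [DecidableEq V]

theorem not_colorConflict_update {α : Type*} [Fintype α] [DecidableEq α] {col : V → α → ℕ}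
    {ω : V → Perm α} {u v : V} {ρ : Perm α} (hu : u ≠ v) {i : α}
    (hω : ¬ ColorConflict G col ω u i (ω u i)) (hρ : ρ ∈ avoidingPerms (ColorConflict G col ω v)) :
    ¬ ColorConflict G col (Function.update ω v ρ) u i (ω u i) := by
  rintro ⟨w, h1, h2⟩
  by_cases hw : w = v
  · subst hw
    rw [Function.update_self] at h2
    exact mem_avoidingPerms.1 hρ i ⟨u, h1.symm, h2.symm⟩
  · rw [Function.update_of_ne hw] at h2
    exact hω ⟨w, h1, h2⟩

theorem isListPacking_update_iff {q : ℕ} {L : V → Finset ℕ} {hL : ∀ v, (L v).card = q}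
    (ω : PackingState G L hL) (u : V) (ρ : Perm (Fin q)) :
    IsListPacking G L (coloringsOf L hL (Function.update ω.1 u ρ)) ↔
      ρ ∈ avoidingPerms
        (ColorConflict G (fun v => (L v).orderEmbOfFin (hL v)) ω.1 u) := by
  have hω := isListPacking_coloringsOf_iff.1 ω.2
  rw [isListPacking_coloringsOf_iff]
  constructor
  · intro h
    rw [mem_avoidingPerms]
    intro i
    have := h u i
    rwa [colorConflict_update_of_not_adj (G.loopless.irrefl u), Function.update_self] at this
  · intro h w i
    by_cases hw : w = u
    · subst hw
      rw [colorConflict_update_of_not_adj (G.loopless.irrefl w), Function.update_self]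
      exact mem_avoidingPerms.1 h i
    · rw [Function.update_of_ne hw]
      exact not_colorConflict_update hw (hω w i) h

/-- Greedy: resampling `v` against all its neighbours, treated or not, creates no conflict at
vertices already treated. -/
theorem nonempty_packingState [Fintype V] [DecidableRel G.Adj] {q : ℕ} {L : V → Finset ℕ}
    (hL : ∀ v, (L v).card = q) {D : ℕ} (hdeg : ∀ v, G.degree v ≤ D) (hq : 2 * D + 2 ≤ q) :
    Nonempty (PackingState G L hL) := by
  set col : V → Fin q → ℕ := fun v => (L v).orderEmbOfFin (hL v)
  have key : ∀ s : Finset V, ∃ ω : V → Perm (Fin q),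
      ∀ u ∈ s, ∀ i, ¬ ColorConflict G col ω u i (ω u i) := by
    intro s
    induction s using Finset.induction_on with
    | empty => exact ⟨1, by simp⟩
    | insert v s hv ih =>
      obtain ⟨ω, hω⟩ := ih
      obtain ⟨ρ, hρ⟩ := avoidingPerms_nonempty (degreeLE_colorConflict (G := G) (col := col)
        (fun v => ((L v).orderEmbOfFin (hL v)).injective) hdeg ω v) (by simpa using hq)
      refine ⟨Function.update ω v ρ, fun u hu i => ?_⟩
      by_cases huv : u = v
      · subst huv
        rw [colorConflict_update_of_not_adj (G.loopless.irrefl u), Function.update_self]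
        exact mem_avoidingPerms.1 hρ i
      · rw [Function.update_of_ne huv]
        exact not_colorConflict_update huv (hω u (mem_of_mem_insert_of_ne hu huv) i) hρ
  obtain ⟨ω, hω⟩ := key univ
  exact ⟨⟨ω, isListPacking_coloringsOf_iff.2 fun u => hω u (mem_univ u)⟩⟩

variable {q : ℕ} {L : V → Finset ℕ} {hL : ∀ v, (L v).card = q}

theorem sum_availablePerm {M : Type*} [AddCommMonoid M] (ω : PackingState G L hL) (u : V)
    (g : Perm (Fin q) → M) :
    ∑ ρ : AvailablePerm G L hL ω u, g ρ.1 =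
      ∑ ρ ∈ avoidingPerms (ColorConflict G (fun v => (L v).orderEmbOfFin (hL v)) ω.1 u), g ρ :=
  sum_bij' (fun ρ _ => ρ.1) (fun ρ h => ⟨ρ, (isListPacking_update_iff ω u ρ).2 h⟩)
    (fun ρ _ => (isListPacking_update_iff ω u ρ.1).1 ρ.2) (fun _ _ => mem_univ _)
    (fun _ _ => rfl) (fun _ _ => rfl) (fun _ _ => rfl)

theorem card_availablePerm (ω : PackingState G L hL) (u : V) :
    Fintype.card (AvailablePerm G L hL ω u) =
      #(avoidingPerms (ColorConflict G (fun v => (L v).orderEmbOfFin (hL v)) ω.1 u)) := by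
  rw [card_eq_sum_ones, ← sum_availablePerm ω u fun _ => 1, ← card_eq_sum_ones, card_univ]

theorem map_uniform_availablePerm_apply (ω ω' : PackingState G L hL) (u : V)
    [Decidable (∀ w, w ≠ u → ω'.1 w = ω.1 w)] :
    ((PMF.uniformOfFintype (AvailablePerm G L hL ω u)).map fun ρ =>
      (⟨Function.update ω.1 u ρ.1, ρ.2⟩ : PackingState G L hL)) ω' =
      if ∀ w, w ≠ u → ω'.1 w = ω.1 w then
        (#(avoidingPerms
          (ColorConflict G (fun v => (L v).orderEmbOfFin (hL v)) ω.1 u)) : ℝ≥0∞)⁻¹ else 0 := by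
  classical
  refine (PMF.map_apply _ _ _).trans ?_
  split_ifs with h
  · have e : Function.update ω.1 u (ω'.1 u) = ω'.1 := by
      rw [Function.update_eq_iff]
      exact ⟨rfl, fun w hw => (h w hw).symm⟩
    rw [tsum_eq_single ⟨ω'.1 u, by rw [e]; exact ω'.2⟩]
    · refine (if_pos (Subtype.ext e.symm)).trans ?_
      refine (PMF.uniformOfFintype_apply _).trans ?_
      rw [card_availablePerm]
    · intro ρ hρ
      rw [if_neg]
      intro h1
      refine hρ (Subtype.ext ?_)
      have := congrArg (fun x => x.1 u) h1
      simpa using this.symm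
  · refine ENNReal.tsum_eq_zero.2 fun ρ => if_neg fun h1 => h fun w hw => ?_
    rw [h1]
    exact Function.update_of_ne hw _ _

variable [Fintype V] [Nonempty V]

/-- Conflicts at `u` depend only on its neighbours, so states differing only at `u` have the same
number of available permutations there. -/
theorem glauberStep_symm (ω ω' : PackingState G L hL) :
    glauberStep G L hL ω ω' = glauberStep G L hL ω' ω := by
  classical
  rw [glauberStep, glauberStep, PMF.bind_apply, PMF.bind_apply]
  refine tsum_congr fun u => ?_
  refine congrArg (_ * ·) ((map_uniform_availablePerm_apply ω ω' u).trans
    (Eq.trans ?_ (map_uniform_availablePerm_apply ω' ω u).symm))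
  by_cases h : ∀ w, w ≠ u → ω'.1 w = ω.1 w
  · have h' : ∀ w, w ≠ u → ω.1 w = ω'.1 w := fun w hw => (h w hw).symm
    have e : Function.update ω.1 u (ω'.1 u) = ω'.1 := by
      rw [Function.update_eq_iff]
      exact ⟨rfl, h'⟩
    rw [if_pos h, if_pos h', ← e, colorConflict_update_of_not_adj (G.loopless.irrefl u)]
  · rw [if_neg h, if_neg fun h' => h fun w hw => (h' w hw).symm]

theorem pmfExp_glauberStep (ω : PackingState G L hL) (f : (V → Perm (Fin q)) → ℝ) :
    pmfExp (glauberStep G L hL ω) (fun ω => f ω.1) =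
      heatBath G (fun v => (L v).orderEmbOfFin (hL v)) f ω.1 := by
  rw [glauberStep, pmfExp_bind, pmfExp_uniformOfFintype, heatBath]
  congr 1
  refine sum_congr rfl fun u _ => ?_
  refine (pmfExp_map _ _ _).trans ?_
  rw [pmfExp_uniformOfFintype, card_availablePerm, resampleAvg, finsetAvg, ← sum_availablePerm]

theorem pmfExp_distAfter (p : PMF (PackingState G L hL)) (f : (V → Perm (Fin q)) → ℝ) (t : ℕ) :
    pmfExp (distAfter (glauberStep G L hL) p t) (fun ω => f ω.1) =
      pmfExp p fun ω =>
        (heatBath G (fun v => (L v).orderEmbOfFin (hL v)))^[t] f ω.1 := by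
  induction t generalizing f with
  | zero => rfl
  | succ t ih =>
    rw [distAfter, pmfExp_bind]
    simp only [pmfExp_glauberStep]
    rw [ih, Function.iterate_succ_apply]

theorem tvDistance_distAfter_le [DecidableRel G.Adj] {D : ℕ} (hdeg : ∀ v, G.degree v ≤ D)
    (hD1 : 1 ≤ D) (hD : 288 * D ^ 2 ≤ q) (p p' : PMF (PackingState G L hL)) (t : ℕ) :
    tvDistance (distAfter (glauberStep G L hL) p t) (distAfter (glauberStep G L hL) p' t) ≤
      2 * q * Fintype.card V * Real.exp (-(t / (2 * Fintype.card V))) := by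
  classical
  set μ := distAfter (glauberStep G L hL) p t with hμ
  set ν := distAfter (glauberStep G L hL) p' t with hν
  -- The extremal sign function, extended by zero off the packings; being bounded by 1, it is
  -- Lipschitz with constant 2.
  set f : (V → Perm (Fin q)) → ℝ := fun ω =>
    if h : IsListPacking G L (coloringsOf L hL ω) then
      if (ν ⟨ω, h⟩).toReal ≤ (μ ⟨ω, h⟩).toReal then 1 else -1
    else 0 with hf
  have hf1 : ∀ ω, |f ω| ≤ 1 := by
    intro ω
    rw [hf]
    dsimp only
    split_ifs <;> simp
  have hlip : SiteLipschitz f 2 := by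
    intro ω v σ i j
    refine (abs_sub _ _).trans ?_
    linarith [hf1 (Function.update ω v (σ * swap i j)), hf1 (Function.update ω v σ)]
  have hfv : ∀ ω : PackingState G L hL,
      f ω.1 = if (ν ω).toReal ≤ (μ ω).toReal then 1 else -1 := by
    intro ω
    rw [hf]
    dsimp only
    rw [dif_pos ω.2]
    rfl
  rw [tvDistance_eq_pmfExp_sign]
  simp only [← hfv]
  rw [hμ, hν, pmfExp_distAfter, pmfExp_distAfter]
  have h1 := hlip.iterate_heatBath (G := G) (col := fun v => (L v).orderEmbOfFin (hL v))
    (fun v => ((L v).orderEmbOfFin (hL v)).injective) hdeg hD1 (by simpa using hD) (by norm_num) t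
  have hn : (1 : ℝ) ≤ Fintype.card V := by exact_mod_cast Fintype.card_pos
  have h0 : (0 : ℝ) ≤ 1 - 1 / (2 * Fintype.card V) := by
    rw [sub_nonneg, div_le_one (by positivity)]
    linarith
  have h2 := pmfExp_sub_le (p := p) (p' := p') fun x y =>
    (le_abs_self _).trans (h1.abs_sub_le (by positivity) x.1 y.1)
  have h3 : (1 - 1 / (2 * (Fintype.card V : ℝ))) ^ t ≤
      Real.exp (-(t / (2 * Fintype.card V))) := by
    have h4 : -((t : ℝ) / (2 * Fintype.card V)) = t * (-(1 / (2 * Fintype.card V))) := by ring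
    rw [h4, Real.exp_nat_mul]
    exact pow_le_pow_left₀ h0 (Real.one_sub_le_exp_neg _) t
  rw [Fintype.card_fin] at h2
  calc _ ≤ 1 / 2 * (2 * ((Fintype.card V : ℝ) * (q *
          ((1 - 1 / (2 * (Fintype.card V : ℝ))) ^ t * 2)))) := by gcongr
    _ = 2 * q * Fintype.card V * (1 - 1 / (2 * (Fintype.card V : ℝ))) ^ t := by ring
    _ ≤ _ := by gcongr

/-- Two stationary laws do not move, yet their distance is bounded by a quantity tending to zero in
`t`. -/
theorem isStationaryDist_glauberStep_iff [DecidableRel G.Adj] {D : ℕ}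
    (hdeg : ∀ v, G.degree v ≤ D) (hD1 : 1 ≤ D) (hD : 288 * D ^ 2 ≤ q)
    {π : PMF (PackingState G L hL)} (hπ : IsStationaryDist (glauberStep G L hL) π)
    (π' : PMF (PackingState G L hL)) :
    IsStationaryDist (glauberStep G L hL) π' ↔ π' = π := by
  refine ⟨fun h => eq_of_tvDistance_le_zero ?_, fun h => h ▸ hπ⟩
  have hn : (0 : ℝ) < Fintype.card V := by exact_mod_cast Fintype.card_pos
  have hlim : Filter.Tendsto (fun t : ℕ => 2 * q * Fintype.card V *
      Real.exp (-((t : ℝ) / (2 * Fintype.card V)))) Filter.atTop (nhds 0) := by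
    rw [← mul_zero (2 * (q : ℝ) * Fintype.card V)]
    refine Filter.Tendsto.const_mul _ (Real.tendsto_exp_neg_atTop_nhds_zero.comp ?_)
    exact tendsto_natCast_atTop_atTop.atTop_div_const (by positivity)
  refine ge_of_tendsto' hlim fun t => ?_
  have := tvDistance_distAfter_le hdeg hD1 hD π' π t
  rwa [distAfter_of_isStationaryDist h, distAfter_of_isStationaryDist hπ] at this

theorem mixingTime_glauberStep_le [DecidableRel G.Adj] {D : ℕ}
    (hdeg : ∀ v, G.degree v ≤ D) (hD1 : 1 ≤ D) (hD : 288 * D ^ 2 ≤ q)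
    {π : PMF (PackingState G L hL)} (hπ : IsStationaryDist (glauberStep G L hL) π)
    {ε : ℝ} (hε : 0 < ε) :
    mixingTime (glauberStep G L hL) π ε ≤
      (⌈2 * Fintype.card V * Real.log (2 * q * Fintype.card V / ε)⌉₊ : ℕ) := by
  refine iSup_le fun p => iInf₂_le _ ?_
  have h := tvDistance_distAfter_le hdeg hD1 hD p π
    ⌈2 * Fintype.card V * Real.log (2 * q * Fintype.card V / ε)⌉₊
  rw [distAfter_of_isStationaryDist hπ] at h
  refine h.trans ?_
  have hn : (0 : ℝ) < Fintype.card V := by exact_mod_cast Fintype.card_pos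
  have hq : (0 : ℝ) < q := by
    have : 0 < q := by nlinarith
    exact_mod_cast this
  have h1 : Real.exp (-((⌈2 * Fintype.card V * Real.log (2 * q * Fintype.card V / ε)⌉₊ : ℕ) /
      (2 * (Fintype.card V : ℝ)))) ≤ Real.exp (-Real.log (2 * q * Fintype.card V / ε)) := by
    rw [Real.exp_le_exp, neg_le_neg_iff, le_div_iff₀ (by positivity), mul_comm]
    exact Nat.le_ceil _
  rw [Real.exp_neg (Real.log _), Real.exp_log (by positivity)] at h1
  calc _ ≤ 2 * q * Fintype.card V * (2 * q * (Fintype.card V : ℝ) / ε)⁻¹ := by gcongr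
    _ = ε := by field_simp

end Packings

/-! ### Constants and conclusion. -/

/-- Since `n / ε ≥ 2`, multiples of `log (n / ε)` absorb both `log (2 * q)` and the rounding error.
-/
theorem ceil_mul_log_le {n q ε : ℝ} (hn : 2 ≤ n) (hq : 1 ≤ q) (hε : 0 < ε) (hε1 : ε < 1) :
    (⌈2 * n * Real.log (2 * q * n / ε)⌉₊ : ℝ) ≤
      (2 * (1 + Real.log (2 * q) / Real.log 2) + 1 / Real.log 2) * (n * Real.log (n / ε)) := by
  have hl : 0 < Real.log 2 := Real.log_pos (by norm_num)
  have h1 : Real.log 2 ≤ Real.log (n / ε) := by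
    refine Real.log_le_log (by norm_num) ?_
    rw [le_div_iff₀ hε]
    nlinarith
  have h2 : 0 ≤ Real.log (2 * q) := Real.log_nonneg (by linarith)
  have h3 : Real.log (2 * q * n / ε) = Real.log (2 * q) + Real.log (n / ε) := by
    rw [mul_div_assoc, Real.log_mul (by positivity) (by positivity)]
  have h4 : (⌈2 * n * Real.log (2 * q * n / ε)⌉₊ : ℝ) ≤ 2 * n * Real.log (2 * q * n / ε) + 1 := by
    refine (Nat.ceil_lt_add_one ?_).le
    rw [h3]
    have : 0 ≤ Real.log (n / ε) := hl.le.trans h1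
    positivity
  have h5 : Real.log (2 * q) ≤ Real.log (2 * q) / Real.log 2 * Real.log (n / ε) := by
    rw [div_mul_eq_mul_div, le_div_iff₀ hl]
    gcongr
  have h6 : 1 ≤ 1 / Real.log 2 * (n * Real.log (n / ε)) := by
    rw [one_div_mul_eq_div, one_le_div hl]
    nlinarith
  rw [h3] at h4 ⊢
  nlinarith

theorem mainTheorem2 :
    ∃ C : ℝ, 0 < C ∧ ∀ Δ q : ℕ, 1 ≤ Δ → C * (Δ : ℝ) ^ 2 ≤ (q : ℝ) →
      ∃ K : ℝ, 0 < K ∧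
        ∀ (V : Type*) [Fintype V] [Nonempty V] [DecidableEq V]
          (G : SimpleGraph V) [DecidableRel G.Adj], G.maxDegree = Δ →
          ∀ (L : V → Finset ℕ) (hL : ∀ v, (L v).card = q),
            ∃ π : PMF (PackingState G L hL),
              (∀ ω, π ω = (Fintype.card (PackingState G L hL) : ℝ≥0∞)⁻¹) ∧
              (∀ π' : PMF (PackingState G L hL),
                IsStationaryDist (glauberStep G L hL) π' ↔ π' = π) ∧
              ∀ ε : ℝ, 0 < ε → ε < 1 →
                (mixingTime (glauberStep G L hL) π ε : ℝ≥0∞) ≤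
                  ENNReal.ofReal (K * ((Fintype.card V : ℝ) *
                    Real.log ((Fintype.card V : ℝ) / ε))) := by
  refine ⟨288, by norm_num, fun Δ q hΔ hq => ?_⟩
  have hq' : 288 * Δ ^ 2 ≤ q := by exact_mod_cast hq
  have hq1 : (1 : ℝ) ≤ q := by
    have : 1 ≤ q := by nlinarith
    exact_mod_cast this
  have hl : 0 < Real.log 2 := Real.log_pos (by norm_num)
  have hlq : 0 ≤ Real.log (2 * q) := Real.log_nonneg (by linarith)
  refine ⟨2 * (1 + Real.log (2 * q) / Real.log 2) + 1 / Real.log 2, by positivity, ?_⟩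
  intro V _ _ _ G _ hG L hL
  have hdeg : ∀ v, G.degree v ≤ Δ := fun v => hG ▸ G.degree_le_maxDegree v
  -- Maximum degree at least 1 forces two vertices, which keeps `log (n / ε)` away from zero.
  have hn : (2 : ℝ) ≤ Fintype.card V := by
    have h1 := G.maxDegree_lt_card_verts
    have : 2 ≤ Fintype.card V := by omega
    exact_mod_cast this
  have : Nonempty (PackingState G L hL) := nonempty_packingState hL hdeg (by nlinarith)
  have hstat : IsStationaryDist (glauberStep G L hL)
      (PMF.uniformOfFintype (PackingState G L hL)) :=
    isStationaryDist_of_symmetric glauberStep_symm fun ω => PMF.uniformOfFintype_apply ω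
  refine ⟨PMF.uniformOfFintype _, fun ω => PMF.uniformOfFintype_apply ω,
    isStationaryDist_glauberStep_iff hdeg hΔ hq' hstat, fun ε hε hε1 => ?_⟩
  have h1 := mixingTime_glauberStep_le hdeg hΔ hq' hstat hε
  calc (mixingTime (glauberStep G L hL) (PMF.uniformOfFintype _) ε : ℝ≥0∞) ≤
      ((⌈2 * Fintype.card V * Real.log (2 * q * Fintype.card V / ε)⌉₊ : ℕ∞) : ℝ≥0∞) := by
        exact_mod_cast h1
    _ = ENNReal.ofReal
        (⌈2 * Fintype.card V * Real.log (2 * q * Fintype.card V / ε)⌉₊ : ℕ) := by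
        rw [ENNReal.ofReal_natCast]; rfl
    _ ≤ _ := ENNReal.ofReal_le_ofReal (ceil_mul_log_le hn hq1 hε hε1)
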